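/- Let $d\in\mathbb N$ and $\sigma,\tau\in\mathbb R$. There are constants $c,C>0$, depending only on $d,\sigma,\tau$, such that the following holds. Let $\Omega\subset\mathbb R^d$ be an open set with $\Omega=\operatorname{int}\overline\Omega$ (for instance a bounded Lipschitz domain), let $\mathcal T_h$ be a finite conforming triangulation by nondegenerate closed $d$-simplices with $\bigcup_{K\in\mathcal T_h}K=\overline\Omega$, and put $h_K=\operatorname{diam}K$, $h=\max_K h_K$. Assume that $\mathcal T_h$ is shape regular with constant $\sigma$ (every $K$ contains a ball of diameter $\rho_K>0$ with $h_K\le\sigma\rho_K$) and quasiuniform with constant $\tau$ ($h\le\tau h_K$ for all $K$). Let $\Omega_k\subset\Omega$ be any subset (for instance one of the two subdomains into which an interface $\Gamma$ divides $\Omega$), let $\delta\ge0$, let $\mathcal T_{h,k}$ be the set of those $K\in\mathcal T_h$ that contain a point $x$ with $\operatorname{dist}(x,\Omega_k)\le\delta$, and let $\Omega_{h,k}=\operatorname{int}\bigcup_{K\in\mathcal T_{h,k}}K$. Let $V_{h,k}$ be the space of continuous functions that are affine on every $K\in\mathcal T_{h,k}$ and vanish on $\partial\Omega\cap\partial\Omega_{h,k}$,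 with nodal basis $\varphi_1,\dots,\varphi_N$. For $\mathbf v\in L^2(\Omega_{h,k})^d$ define the lumped-mass projection $$\mathcal P_k\mathbf v=\sum_{j=1}^N\mathbf g_j(\mathbf v)\,\varphi_j,\qquad \mathbf g_j(\mathbf v)=\frac{\int_{\Omega_{h,k}}\mathbf v\,\varphi_j\,dx}{\int_{\Omega_{h,k}}\varphi_j\,dx},$$ and for $u,v\in H^1(\Omega_{h,k})$ put $$s_{h,k}(u,v)=\int_{\Omega_{h,k}}(\nabla u-\mathcal P_k\nabla u)\cdot\nabla v\,dx .$$ Then $s_{h,k}$ is a symmetric, positive semidefinite bilinear form on $H^1(\Omega_{h,k})$, and for all $u\in H^1(\Omega_{h,k})$, with $$R(u)=\|\nabla u-\mathcal P_k\nabla u\|_{L^2(\Omega_{h,k})}^2+h^2\|\nabla\mathcal P_k\nabla u\|_{L^2(\Omega_{h,k})}^2$$ (the Frobenius norm being used for the matrix field $\nabla\mathcal P_k\nabla u$), one has $$c\,R(u)\le s_{h,k}(u,u)\le C\,R(u).$$ -/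

import Mathlib

open MeasureTheory Set
open scoped ContDiff

noncomputable section

namespace PG

/-- `ℝ^d` with its Euclidean structure. -/
abbrev Pt (d : ℕ) := EuclideanSpace ℝ (Fin d)

/-- A conforming triangulation: a finite set of nondegenerate `d`-simplices, each one given by its
set of `d + 1` vertices, any two of which meet exactly in the (possibly empty) simplex spanned by
their common vertices. -/
structure Mesh (d : ℕ) where
  cells : Finset (Finset (Pt d))
  card_eq : ∀ K ∈ cells, K.card = d + 1
  indep : ∀ K ∈ cells, AffineIndependent ℝ ((↑) : K → Pt d)
  conforming : ∀ K ∈ cells, ∀ L ∈ cells,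
    convexHull ℝ (K : Set (Pt d)) ∩ convexHull ℝ (L : Set (Pt d)) ⊆
      convexHull ℝ ((K : Set (Pt d)) ∩ (L : Set (Pt d)))

/-- The closed simplex with vertex set `K`. -/
def simplex {d : ℕ} (K : Finset (Pt d)) : Set (Pt d) := convexHull ℝ (K : Set (Pt d))

namespace Mesh

variable {d : ℕ}

/-- The union of the closed simplices of the mesh. -/
def space (T : Mesh d) : Set (Pt d) := ⋃ K ∈ T.cells, simplex K

/-- The open domain covered by the mesh: the interior of the union of its simplices. -/
def domain (T : Mesh d) : Set (Pt d) := interior T.space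

/-- The mesh size `h = max_K h_K` with `h_K = diam K` (and `h = 0` for the empty mesh). -/
def meshSize (T : Mesh d) : ℝ :=
  sSup ((fun K => Metric.diam (simplex K)) '' (T.cells : Set (Finset (Pt d))))

/-- Shape regularity with constant `σ`: every simplex `K` contains a ball whose diameter `2 * r`
satisfies `diam K ≤ σ * (2 * r)`. -/
def ShapeRegular (T : Mesh d) (σ : ℝ) : Prop :=
  ∀ K ∈ T.cells, ∃ (x : Pt d) (r : ℝ), 0 < r ∧ Metric.closedBall x r ⊆ simplex K ∧
    Metric.diam (simplex K) ≤ σ * (2 * r)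

/-- Quasiuniformity with constant `τ`: `h ≤ τ * h_K` for every simplex `K`. -/
def QuasiUniform (T : Mesh d) (τ : ℝ) : Prop :=
  ∀ K ∈ T.cells, T.meshSize ≤ τ * Metric.diam (simplex K)

open Classical in
/-- The sub-triangulation of all simplices that contain a point at distance at most `δ`
from the set `D`. -/
def sub (T : Mesh d) (D : Set (Pt d)) (δ : ℝ) : Mesh d where
  cells := T.cells.filter fun K => (simplex K ∩ Metric.cthickening δ D).Nonempty
  card_eq K hK := T.card_eq K (Finset.mem_filter.1 hK).1
  indep K hK := T.indep K (Finset.mem_filter.1 hK).1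
  conforming K hK L hL :=
    T.conforming K (Finset.mem_filter.1 hK).1 L (Finset.mem_filter.1 hL).1

/-- The vertices of a cell as an affine basis of `ℝ^d`; its coordinate functions are the
barycentric coordinates of the cell. -/
def basis (T : Mesh d) (K : Finset (Pt d)) (hK : K ∈ T.cells) : AffineBasis K ℝ (Pt d) :=
  ⟨((↑) : K → Pt d), T.indep K hK, by
    rw [(T.indep K hK).affineSpan_eq_top_iff_card_eq_finrank_add_one]
    simp [T.card_eq K hK]⟩

open Classical in
/-- The vertices of the mesh. -/
def vertices (T : Mesh d) : Finset (Pt d) := T.cells.biUnion id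

open Classical in
/-- The continuous piecewise affine (P1) nodal function of the vertex `p`: on a cell with vertex `p`
it is the barycentric coordinate belonging to `p`, elsewhere it is `0`. By conformity the value at
a point does not depend on the cell used to compute it, see `hat_eq_coord`. -/
def hat (T : Mesh d) (p x : Pt d) : ℝ :=
  if h : ∃ K : Finset (Pt d), K ∈ T.cells ∧ p ∈ K ∧ x ∈ simplex K then
    (T.basis h.choose h.choose_spec.1).coord ⟨p, h.choose_spec.2.1⟩ x
  else 0

open Classical in
/-- The nodes `x_j` of the P1 space `V` of continuous functions that are affine on every cell and
vanish on `∂Ω ∩ ∂(T.domain)`: the vertices whose nodal function belongs to `V`. As this boundary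
part consists of faces of the mesh, the functions `T.hat p`, `p ∈ T.nodes Ω`, are the nodal basis
of `V`. -/
def nodes (T : Mesh d) (Ω : Set (Pt d)) : Finset (Pt d) :=
  T.vertices.filter fun p => ∀ x ∈ frontier Ω ∩ frontier T.domain, T.hat p x = 0

/-- The coefficient `g_p(v) = (∫ v φ_p) / (∫ φ_p)`. -/
def coeff (T : Mesh d) (v : Pt d → Pt d) (p : Pt d) : Pt d :=
  (∫ x in T.domain, T.hat p x)⁻¹ • ∫ x in T.domain, T.hat p x • v x

/-- The lumped-mass projection `P v = ∑_p g_p(v) φ_p`. -/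
def proj (T : Mesh d) (Ω : Set (Pt d)) (v : Pt d → Pt d) (x : Pt d) : Pt d :=
  ∑ p ∈ T.nodes Ω, T.hat p x • T.coeff v p

end Mesh

variable {d : ℕ}

/-- `g ∈ L²(U)^d` is the weak gradient of `u` on the open set `U`. -/
def IsWeakGrad (U : Set (Pt d)) (u : Pt d → ℝ) (g : Pt d → Pt d) : Prop :=
  MemLp g 2 (volume.restrict U) ∧
    ∀ φ : Pt d → ℝ, ContDiff ℝ ∞ φ → HasCompactSupport φ → tsupport φ ⊆ U →
      ∫ x in U, u x • gradient φ x = - ∫ x in U, φ x • g x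

/-- `u ∈ H¹(U)`. -/
def MemH1 (U : Set (Pt d)) (u : Pt d → ℝ) : Prop :=
  MemLp u 2 (volume.restrict U) ∧ ∃ g, IsWeakGrad U u g

open Classical in
/-- The weak gradient of `u` on `U` (unique almost everywhere on `U`). -/
def weakGrad (U : Set (Pt d)) (u : Pt d → ℝ) : Pt d → Pt d :=
  if h : ∃ g, IsWeakGrad U u g then h.choose else 0

/-- The stabilization form `s(u, v) = ∫ (∇u - P∇u) · ∇v` over the domain of the mesh `T`. -/
def stabForm (T : Mesh d) (Ω : Set (Pt d)) (u v : Pt d → ℝ) : ℝ :=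
  ∫ x in T.domain,
    inner ℝ (weakGrad T.domain u x - T.proj Ω (weakGrad T.domain u) x) (weakGrad T.domain v x)

/-- `‖∇u - P∇u‖²` in `L²` over the domain of the mesh `T`. -/
def fluctSq (T : Mesh d) (Ω : Set (Pt d)) (u : Pt d → ℝ) : ℝ :=
  ∫ x in T.domain, ‖weakGrad T.domain u x - T.proj Ω (weakGrad T.domain u) x‖ ^ 2

/-- `‖∇P∇u‖²` in `L²` over the domain of the mesh `T`, with the Frobenius norm of the matrix field
`∇P∇u`. As `P∇u` is continuous and affine on every cell, its gradient is taken classically; it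
exists off the faces of the cells, which form a null set. -/
def projGradSq (T : Mesh d) (Ω : Set (Pt d)) (u : Pt d → ℝ) : ℝ :=
  ∫ x in T.domain,
    ∑ i : Fin d, ‖gradient (fun y => T.proj Ω (weakGrad T.domain u) y i) x‖ ^ 2

namespace Mesh

theorem coord_of_sum (T : Mesh d) {K S : Finset (Pt d)} (hK : K ∈ T.cells) (hS : S ⊆ K)
    {p x : Pt d} (hp : p ∈ K) {w : Pt d → ℝ} (hw : ∑ q ∈ S, w q = 1) (hx : ∑ q ∈ S, w q • q = x) :
    (T.basis K hK).coord ⟨p, hp⟩ x = ∑ q ∈ S, if q = p then w q else 0 := by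
  set f := (T.basis K hK).coord ⟨p, hp⟩ with hf
  have key : ∀ y, f y = f.linear y + f 0 := fun y => by
    rw [AffineMap.decomp' f]; simp
  rw [key, ← hx, map_sum]
  have h0 : f 0 = ∑ q ∈ S, w q * f 0 := by rw [← Finset.sum_mul, hw, one_mul]
  rw [h0, ← Finset.sum_add_distrib]
  refine Finset.sum_congr rfl fun q hq => ?_
  have hq1 : f q = if q = p then 1 else 0 := by
    have h1 := (T.basis K hK).coord_apply ⟨p, hp⟩ ⟨q, hS hq⟩
    have h2 : (T.basis K hK) ⟨q, hS hq⟩ = q := rfl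
    rw [h2, ← hf] at h1
    rw [h1]
    simp [eq_comm]
  rw [map_smul, smul_eq_mul, ← mul_add, ← key, hq1]
  simp

/-- On a cell `K` that meets a cell `L` in `x`, the point `x` is a convex combination of the common
vertices. -/
theorem exists_weights (T : Mesh d) {K L : Finset (Pt d)} (hK : K ∈ T.cells) (hL : L ∈ T.cells)
    {x : Pt d} (hx : x ∈ simplex K) (hx1 : x ∈ simplex L) :
    ∃ (S : Finset (Pt d)) (w : Pt d → ℝ), S ⊆ K ∧ S ⊆ L ∧
      ∑ q ∈ S, w q = 1 ∧ ∑ q ∈ S, w q • q = x := by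
  classical
  have h := T.conforming K hK L hL ⟨hx, hx1⟩
  rw [← Finset.coe_inter, Finset.mem_convexHull'] at h
  obtain ⟨w, -, h1, h2⟩ := h
  exact ⟨K ∩ L, w, Finset.inter_subset_left, Finset.inter_subset_right, h1, h2⟩

/-- The nodal function of `p` is the barycentric coordinate on every cell containing `p`. -/
theorem hat_eq_coord (T : Mesh d) {K : Finset (Pt d)} (hK : K ∈ T.cells) {p x : Pt d} (hp : p ∈ K)
    (hx : x ∈ simplex K) : T.hat p x = (T.basis K hK).coord ⟨p, hp⟩ x := by
  have h : ∃ K : Finset (Pt d), K ∈ T.cells ∧ p ∈ K ∧ x ∈ simplex K := ⟨K, hK, hp, hx⟩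
  have hs := h.choose_spec
  rw [hat, dif_pos h]
  obtain ⟨S, w, hSK, hSL, h1, h2⟩ := T.exists_weights hK hs.1 hx hs.2.2
  rw [T.coord_of_sum hK hSK hp h1 h2, T.coord_of_sum hs.1 hSL hs.2.1 h1 h2]

/-- The nodal function of `p` vanishes on every cell that does not contain `p`. -/
theorem hat_eq_zero (T : Mesh d) {K : Finset (Pt d)} (hK : K ∈ T.cells) {p x : Pt d} (hp : p ∉ K)
    (hx : x ∈ simplex K) : T.hat p x = 0 := by
  by_cases h : ∃ K : Finset (Pt d), K ∈ T.cells ∧ p ∈ K ∧ x ∈ simplex K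
  · have hs := h.choose_spec
    rw [hat, dif_pos h]
    obtain ⟨S, w, hSK, hSL, h1, h2⟩ := T.exists_weights hK hs.1 hx hs.2.2
    rw [T.coord_of_sum hs.1 hSL hs.2.1 h1 h2]
    refine Finset.sum_eq_zero fun q hq => if_neg ?_
    rintro rfl
    exact hp (hSK hq)
  · rw [hat, dif_neg h]

end Mesh

end PG

end

/-! Write `v = ∇u`, `m_p = ∫ φ_p`, and let `g_p` be the moment quotient of `v` at a node and zero at
every other vertex. Extending by zero leaves `Pv` unchanged, but now the sum runs over all vertices,
whose nodal functions are nonnegative and sum to one on the domain.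

Since `m_p g_p = ∫ φ_p v` at the nodes, `∫ Pv · w` equals `∑ m_p g_p(v) · g_p(w)`. Hence the form is
visibly symmetric and bilinear (`stabForm_eq`). On the diagonal, `∫ Pv · v = ∫ ∑ φ_p |g_p|²`, so
`s(u,u) - ‖v - Pv‖² = ∫ (∑ φ_p |g_p|² - |∑ φ_p g_p|²)`. The integrand is the variance of the values
`g_p` under the weights `φ_p(x)`, that is, `½ ∑∑ φ_p φ_q |g_p - g_q|²`. So `s(u,u) = F + J/2` with
`F` the squared fluctuation and `J ≥ 0` an oscillation integral (`stabForm_self_eq`).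

It remains to compare `J` with `h²‖∇Pv‖²` cell by cell. In one direction, vertex values differ by at
most slope times diameter (`integral_hatOsc_le`). In the other, an inscribed ball bounds the slope
by the differences of vertex values, and the products `φ_p φ_q` are bounded below on a shrunken copy
of the cell (`integral_gradSq_le`). -/

noncomputable section

namespace PG

/-! ### The fluctuation form for an abstract family of weights. -/

section PartitionOfUnity

variable {α ι E : Type*} [MeasurableSpace α] {μ : Measure α}
  [NormedAddCommGroup E] [InnerProductSpace ℝ E]

/-- Weighted variance formula for weights that sum to one. -/
theorem half_sum_sum_mul_norm_sub_sq {V : Finset ι} {w : ι → ℝ} (G : ι → E)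
    (hw : ∑ p ∈ V, w p = 1) :
    (1 / 2 : ℝ) * ∑ p ∈ V, ∑ q ∈ V, w p * w q * ‖G p - G q‖ ^ 2 =
      ∑ p ∈ V, w p * ‖G p‖ ^ 2 - ‖∑ p ∈ V, w p • G p‖ ^ 2 := by
  have e1 : ‖∑ p ∈ V, w p • G p‖ ^ 2 = ∑ p ∈ V, ∑ q ∈ V, w p * w q * inner ℝ (G p) (G q) := by
    rw [← real_inner_self_eq_norm_sq, sum_inner]
    refine Finset.sum_congr rfl fun p _ => ?_
    rw [inner_sum]
    refine Finset.sum_congr rfl fun q _ => ?_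
    rw [real_inner_smul_left, real_inner_smul_right]
    ring
  have e2 : ∑ p ∈ V, ∑ q ∈ V, w p * w q * ‖G p‖ ^ 2 = ∑ p ∈ V, w p * ‖G p‖ ^ 2 := by
    refine Finset.sum_congr rfl fun p _ => ?_
    calc ∑ q ∈ V, w p * w q * ‖G p‖ ^ 2 = w p * ‖G p‖ ^ 2 * ∑ q ∈ V, w q := by
          rw [Finset.mul_sum]; exact Finset.sum_congr rfl fun q _ => by ring
      _ = _ := by rw [hw, mul_one]
  have e3 : ∑ p ∈ V, ∑ q ∈ V, w p * w q * ‖G q‖ ^ 2 = ∑ p ∈ V, w p * ‖G p‖ ^ 2 := by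
    rw [Finset.sum_comm, ← e2]
    exact Finset.sum_congr rfl fun p _ => Finset.sum_congr rfl fun q _ => by ring
  have e4 : ∑ p ∈ V, ∑ q ∈ V, w p * w q * ‖G p - G q‖ ^ 2 =
      ∑ p ∈ V, ∑ q ∈ V, w p * w q * ‖G p‖ ^ 2 + ∑ p ∈ V, ∑ q ∈ V, w p * w q * ‖G q‖ ^ 2
        - 2 * ∑ p ∈ V, ∑ q ∈ V, w p * w q * inner ℝ (G p) (G q) := by
    simp only [Finset.mul_sum, ← Finset.sum_add_distrib, ← Finset.sum_sub_distrib]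
    refine Finset.sum_congr rfl fun p _ => Finset.sum_congr rfl fun q _ => ?_
    rw [norm_sub_sq_real]
    ring
  rw [e4, e2, e3, ← e1]
  ring

variable {N : Finset ι} {φ : ι → α → ℝ} {v w : α → E} {g k : ι → E}

theorem memLp_two_smul_of_memLp_top {f : α → ℝ} (hf : MemLp f ⊤ μ) (hv : MemLp v 2 μ) :
    MemLp (fun x => f x • v x) 2 μ := hv.smul hf

theorem integrable_inner_of_memLp_two (hv : MemLp v 2 μ) (hw : MemLp w 2 μ) :
    Integrable (fun x => (inner ℝ (v x) (w x) : ℝ)) μ := by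
  refine (hv.norm.integrable_mul hw.norm).mono' (hv.1.inner hw.1) (ae_of_all _ fun x => ?_)
  exact norm_inner_le_norm (v x) (w x)

theorem memLp_sum_smul_const [IsFiniteMeasure μ] (hφ : ∀ p ∈ N, MemLp (φ p) ⊤ μ) (g : ι → E) :
    MemLp (fun x => ∑ p ∈ N, φ p x • g p) 2 μ := by
  refine memLp_finsetSum N fun p hp => ?_
  exact memLp_two_smul_of_memLp_top (v := fun _ => g p) (hφ p hp) (memLp_const _)

/-- Only the moments of `w` against the weights enter, and these are multiples of `k p`; the result
is a weighted scalar product of the two coefficient families, hence symmetric in them. -/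
theorem integral_inner_sum_smul_const [CompleteSpace E] [IsFiniteMeasure μ]
    (hφ : ∀ p ∈ N, MemLp (φ p) ⊤ μ) (hw : MemLp w 2 μ)
    (hk : ∀ p ∈ N, (∫ x, φ p x ∂μ) • k p = ∫ x, φ p x • w x ∂μ) :
    ∫ x, inner ℝ (∑ p ∈ N, φ p x • g p) (w x) ∂μ =
      ∑ p ∈ N, (∫ x, φ p x ∂μ) * inner ℝ (g p) (k p) := by
  have hi : ∀ p ∈ N, Integrable (fun x => φ p x • w x) μ := fun p hp =>
    (memLp_two_smul_of_memLp_top (hφ p hp) hw).integrable one_le_two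
  have e : ∀ x, inner ℝ (∑ p ∈ N, φ p x • g p) (w x) = ∑ p ∈ N, inner ℝ (g p) (φ p x • w x) := by
    intro x
    rw [sum_inner]
    exact Finset.sum_congr rfl fun p _ => by
      rw [real_inner_smul_left, real_inner_smul_right]
  simp_rw [e]
  rw [integral_finsetSum _ fun p hp => (hi p hp).const_inner (g p)]
  refine Finset.sum_congr rfl fun p hp => ?_
  rw [integral_inner (hi p hp), ← hk p hp, real_inner_smul_right]

/-- The symmetric representation of the fluctuation form. -/
theorem integral_inner_sub_sum_smul [CompleteSpace E] [IsFiniteMeasure μ]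
    (hφ : ∀ p ∈ N, MemLp (φ p) ⊤ μ) (hv : MemLp v 2 μ) (hw : MemLp w 2 μ)
    (hk : ∀ p ∈ N, (∫ x, φ p x ∂μ) • k p = ∫ x, φ p x • w x ∂μ) :
    ∫ x, inner ℝ (v x - ∑ p ∈ N, φ p x • g p) (w x) ∂μ =
      (∫ x, inner ℝ (v x) (w x) ∂μ) - ∑ p ∈ N, (∫ x, φ p x ∂μ) * inner ℝ (g p) (k p) := by
  rw [← integral_inner_sum_smul_const hφ hw hk, ← integral_sub]
  · simp_rw [inner_sub_left]
  · exact integrable_inner_of_memLp_two hv hw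
  · exact integrable_inner_of_memLp_two (memLp_sum_smul_const hφ g) hw

/-- The fluctuation form on the diagonal splits into the squared fluctuation and the averaged
oscillation of the coefficients. -/
theorem integral_inner_sub_sum_smul_self [CompleteSpace E] [IsFiniteMeasure μ]
    (hφ : ∀ p ∈ N, MemLp (φ p) ⊤ μ) (hone : ∀ᵐ x ∂μ, ∑ p ∈ N, φ p x = 1) (hv : MemLp v 2 μ)
    (hg : ∀ p ∈ N, g p ≠ 0 → (∫ x, φ p x ∂μ) • g p = ∫ x, φ p x • v x ∂μ) :
    ∫ x, inner ℝ (v x - ∑ p ∈ N, φ p x • g p) (v x) ∂μ =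
      (∫ x, ‖v x - ∑ p ∈ N, φ p x • g p‖ ^ 2 ∂μ) +
        (1 / 2 : ℝ) * ∫ x, ∑ p ∈ N, ∑ q ∈ N, φ p x * φ q x * ‖g p - g q‖ ^ 2 ∂μ := by
  classical
  have hP := memLp_sum_smul_const hφ g
  have hd : MemLp (fun x => v x - ∑ p ∈ N, φ p x • g p) 2 μ := hv.sub hP
  have hφi : ∀ p ∈ N, Integrable (φ p) μ := fun p hp => (hφ p hp).integrable le_top
  -- With `P` the weighted sum: `(v - P)·v = |v - P|² + (P·v - |P|²)`. The bracket integrates to the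
  -- averaged variance.
  have e1 : ∀ x, inner ℝ (v x - ∑ p ∈ N, φ p x • g p) (v x) =
      ‖v x - ∑ p ∈ N, φ p x • g p‖ ^ 2 +
        (inner ℝ (∑ p ∈ N, φ p x • g p) (v x) - ‖∑ p ∈ N, φ p x • g p‖ ^ 2) := by
    intro x
    rw [← real_inner_self_eq_norm_sq, ← real_inner_self_eq_norm_sq, inner_sub_left, inner_sub_left,
      inner_sub_right, inner_sub_right, real_inner_comm (v x) (∑ p ∈ N, φ p x • g p)]
    ring
  have hin : Integrable (fun x => inner ℝ (∑ p ∈ N, φ p x • g p) (v x)) μ :=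
    integrable_inner_of_memLp_two hP hv
  have hsq : Integrable (fun x => ‖∑ p ∈ N, φ p x • g p‖ ^ 2) μ := hP.integrable_norm_pow two_ne_zero
  have hsum : Integrable (fun x => ∑ p ∈ N, φ p x * ‖g p‖ ^ 2) μ :=
    integrable_finsetSum _ fun p hp => (hφi p hp).mul_const _
  have e2 : ∫ x, inner ℝ (∑ p ∈ N, φ p x • g p) (v x) ∂μ =
      ∫ x, ∑ p ∈ N, φ p x * ‖g p‖ ^ 2 ∂μ := by
    rw [integral_finsetSum _ fun p hp => (hφi p hp).mul_const _]
    -- The moment identity is available only where `g p ≠ 0`; the remaining indices contribute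
    -- nothing to either side.
    have e : ∀ x, inner ℝ (∑ p ∈ N, φ p x • g p) (v x) =
        inner ℝ (∑ p ∈ N.filter fun p => g p ≠ 0, φ p x • g p) (v x) := by
      intro x
      rw [Finset.sum_filter_of_ne]
      rintro p - h h0
      exact h (by rw [h0, smul_zero])
    simp_rw [e]
    rw [integral_inner_sum_smul_const (k := g) (fun p hp => hφ p (Finset.mem_filter.1 hp).1) hv
      fun p hp => hg p (Finset.mem_filter.1 hp).1 (Finset.mem_filter.1 hp).2,
      Finset.sum_filter_of_ne]
    · exact Finset.sum_congr rfl fun p _ => by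
        rw [real_inner_self_eq_norm_sq, integral_mul_const]
    · rintro p - h h0
      exact h (by rw [h0, inner_zero_left, mul_zero])
  simp_rw [e1]
  have hdiff : Integrable (fun x => (inner ℝ (∑ p ∈ N, φ p x • g p) (v x) : ℝ) -
      ‖∑ p ∈ N, φ p x • g p‖ ^ 2) μ := hin.sub hsq
  rw [integral_add (hd.integrable_norm_pow two_ne_zero) hdiff, integral_sub hin hsq, e2,
    ← integral_sub hsum hsq, ← integral_const_mul]
  congr 1
  refine integral_congr_ae ?_
  filter_upwards [hone] with x hx
  exact (half_sum_sum_mul_norm_sub_sq g hx).symm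

end PartitionOfUnity

/-! ### Simplices, nodal functions and the decomposition of the domain into cells. -/

variable {d : ℕ}

theorem isCompact_simplex (K : Finset (Pt d)) : IsCompact (simplex K) :=
  K.finite_toSet.isCompact_convexHull (𝕜 := ℝ)

theorem convex_simplex (K : Finset (Pt d)) : Convex ℝ (simplex K) := convex_convexHull ℝ _

theorem mem_simplex {K : Finset (Pt d)} {p : Pt d} (hp : p ∈ K) : p ∈ simplex K :=
  subset_convexHull ℝ _ hp

namespace Mesh

variable (T : Mesh d)

theorem range_basis {K : Finset (Pt d)} (hK : K ∈ T.cells) : range (T.basis K hK) = K := by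
  exact Subtype.range_coe

theorem mem_simplex_iff {K : Finset (Pt d)} (hK : K ∈ T.cells) {x : Pt d} :
    x ∈ simplex K ↔ ∀ p, 0 ≤ (T.basis K hK).coord p x := by
  rw [simplex, ← T.range_basis hK, AffineBasis.convexHull_eq_nonneg_coord]
  rfl

theorem mem_space_iff {x : Pt d} : x ∈ T.space ↔ ∃ K ∈ T.cells, x ∈ simplex K := by
  simp [space]

theorem simplex_subset_space {K : Finset (Pt d)} (hK : K ∈ T.cells) : simplex K ⊆ T.space :=
  fun _ hx => T.mem_space_iff.2 ⟨K, hK, hx⟩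

theorem subset_vertices {K : Finset (Pt d)} (hK : K ∈ T.cells) : K ⊆ T.vertices := by
  classical
  exact Finset.subset_biUnion_of_mem id hK

theorem hat_nonneg {x : Pt d} (hx : x ∈ T.space) (p : Pt d) : 0 ≤ T.hat p x := by
  obtain ⟨K, hK, hxK⟩ := T.mem_space_iff.1 hx
  by_cases hp : p ∈ K
  · rw [T.hat_eq_coord hK hp hxK]
    exact (T.mem_simplex_iff hK).1 hxK _
  · rw [T.hat_eq_zero hK hp hxK]

theorem sum_vertices_eq {M : Type*} [AddCommMonoid M] {K : Finset (Pt d)} (hK : K ∈ T.cells)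
    {F : Pt d → M} (hF : ∀ p ∉ K, F p = 0) : ∑ p ∈ T.vertices, F p = ∑ p ∈ K, F p :=
  (Finset.sum_subset (T.subset_vertices hK) fun p _ hp => hF p hp).symm

theorem sum_hat {x : Pt d} (hx : x ∈ T.space) : ∑ p ∈ T.vertices, T.hat p x = 1 := by
  obtain ⟨K, hK, hxK⟩ := T.mem_space_iff.1 hx
  rw [T.sum_vertices_eq hK fun p hp => T.hat_eq_zero hK hp hxK, ← Finset.sum_coe_sort,
    ← (T.basis K hK).sum_coord_apply_eq_one x]
  exact Finset.sum_congr rfl fun p _ => T.hat_eq_coord hK p.2 hxK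

theorem hat_le_one {x : Pt d} (hx : x ∈ T.space) {p : Pt d} (hp : p ∈ T.vertices) :
    T.hat p x ≤ 1 := by
  rw [← T.sum_hat hx]
  exact Finset.single_le_sum (fun q _ => T.hat_nonneg hx q) hp

/-- The affine function on a cell with prescribed values at the vertices. -/
def cellInterp (K : Finset (Pt d)) (hK : K ∈ T.cells) (a : Pt d → ℝ) : Pt d →ᵃ[ℝ] ℝ :=
  (Fintype.linearCombination ℝ fun p : K => a p).toAffineMap.comp (T.basis K hK).coords

theorem cellInterp_apply {K : Finset (Pt d)} (hK : K ∈ T.cells) (a : Pt d → ℝ) (x : Pt d) :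
    T.cellInterp K hK a x = ∑ p : K, (T.basis K hK).coord p x * a p := by
  simp [cellInterp, Fintype.linearCombination_apply]

theorem cellInterp_eq {K : Finset (Pt d)} (hK : K ∈ T.cells) (a : Pt d → ℝ) {x : Pt d}
    (hx : x ∈ simplex K) : T.cellInterp K hK a x = ∑ p ∈ T.vertices, T.hat p x * a p := by
  rw [T.sum_vertices_eq hK fun p hp => by rw [T.hat_eq_zero hK hp hx, zero_mul],
    ← Finset.sum_coe_sort, cellInterp_apply]
  exact Finset.sum_congr rfl fun p _ => by rw [T.hat_eq_coord hK p.2 hx]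

theorem cellInterp_vertex {K : Finset (Pt d)} (hK : K ∈ T.cells) (a : Pt d → ℝ) {p : Pt d}
    (hp : p ∈ K) : T.cellInterp K hK a p = a p := by
  classical
  have h : ∀ q : K, (T.basis K hK).coord q p = if q = ⟨p, hp⟩ then 1 else 0 := fun q =>
    (T.basis K hK).coord_apply q ⟨p, hp⟩
  rw [cellInterp_apply]
  simp [h]

theorem continuousOn_hat {K : Finset (Pt d)} (hK : K ∈ T.cells) (p : Pt d) :
    ContinuousOn (T.hat p) (simplex K) := by
  by_cases hp : p ∈ K
  · exact (continuous_barycentric_coord (T.basis K hK) ⟨p, hp⟩).continuousOn.congr fun x hx =>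
      T.hat_eq_coord hK hp hx
  · exact continuousOn_const.congr fun x hx => T.hat_eq_zero hK hp hx

theorem isCompact_space : IsCompact T.space :=
  T.cells.finite_toSet.isCompact_biUnion fun K _ => isCompact_simplex K

theorem domain_subset_space : T.domain ⊆ T.space := interior_subset

theorem isOpen_domain : IsOpen T.domain := isOpen_interior

instance : IsFiniteMeasure (volume.restrict T.domain) :=
  ⟨by
    rw [Measure.restrict_apply_univ]
    exact (measure_mono T.domain_subset_space).trans_lt T.isCompact_space.measure_lt_top⟩

theorem memLp_hat {p : Pt d} (hp : p ∈ T.vertices) :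
    MemLp (T.hat p) ⊤ (volume.restrict T.domain) := by
  refine memLp_top_of_bound ?_ 1 ?_
  · have h : IntegrableOn (T.hat p) T.space := by
      rw [space, integrableOn_finset_iUnion]
      exact fun K hK => (T.continuousOn_hat hK p).integrableOn_compact (isCompact_simplex K)
    exact (h.mono_set T.domain_subset_space).1
  · refine (ae_restrict_iff' T.isOpen_domain.measurableSet).2 (ae_of_all _ fun x hx => ?_)
    have hx' := T.domain_subset_space hx
    rw [Real.norm_of_nonneg (T.hat_nonneg hx' p)]
    exact T.hat_le_one hx' hp

/-- If the interiors met, conformity would give the hull of the common vertices nonempty interior.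
That forces `d + 1` common vertices, so the two cells would coincide. -/
theorem disjoint_interior {K L : Finset (Pt d)} (hK : K ∈ T.cells) (hL : L ∈ T.cells)
    (hKL : K ≠ L) : Disjoint (interior (simplex K)) (interior (simplex L)) := by
  classical
  rw [Set.disjoint_iff_inter_eq_empty, ← interior_inter]
  by_contra h
  have h1 : (interior (convexHull ℝ ((K ∩ L : Finset (Pt d)) : Set (Pt d)))).Nonempty := by
    rw [Finset.coe_inter]
    exact (nonempty_iff_ne_empty.2 h).mono (interior_mono (T.conforming K hK L hL))
  rw [interior_convexHull_nonempty_iff_affineSpan_eq_top] at h1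
  have hi : AffineIndependent ℝ ((↑) : (K ∩ L : Finset (Pt d)) → Pt d) :=
    (T.indep K hK).mono (Finset.coe_subset.2 Finset.inter_subset_left)
  have h2 : Fintype.card (K ∩ L : Finset (Pt d)) = Module.finrank ℝ (Pt d) + 1 := by
    rw [← hi.affineSpan_eq_top_iff_card_eq_finrank_add_one]
    exact (congrArg (affineSpan ℝ) Subtype.range_coe).trans h1
  rw [Fintype.card_coe, finrank_euclideanSpace_fin] at h2
  have e1 := Finset.eq_of_subset_of_card_le (Finset.inter_subset_left (s₁ := K) (s₂ := L))
    (by rw [h2, T.card_eq K hK])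
  have e2 := Finset.eq_of_subset_of_card_le (Finset.inter_subset_right (s₁ := K) (s₂ := L))
    (by rw [h2, T.card_eq L hL])
  exact hKL (e1.symm.trans e2)

/-- A point of the domain in no open cell lies on the frontier of some cell, and frontiers of convex
sets are null. -/
theorem domain_ae_eq : T.domain =ᵐ[volume] ⋃ K ∈ T.cells, interior (simplex K) := by
  have hsub : (⋃ K ∈ T.cells, interior (simplex K)) ⊆ T.domain :=
    iUnion₂_subset fun K hK => interior_mono (T.simplex_subset_space hK)
  refine Filter.EventuallyLE.antisymm ?_ hsub.eventuallyLE
  rw [ae_le_set]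
  refine measure_mono_null (t := ⋃ K ∈ T.cells, frontier (simplex K)) ?_ ?_
  · rintro x ⟨hx, hx'⟩
    obtain ⟨K, hK, hxK⟩ := T.mem_space_iff.1 (T.domain_subset_space hx)
    refine mem_iUnion₂.2 ⟨K, hK, subset_closure hxK, fun h => hx' (mem_iUnion₂.2 ⟨K, hK, h⟩)⟩
  · exact (measure_biUnion_null_iff T.cells.countable_toSet).2 fun K _ =>
      (convex_simplex K).addHaar_frontier volume

/-- Integrals over the domain are sums of integrals over the open cells. -/
theorem integral_domain {F : Pt d → ℝ}
    (hF : ∀ K ∈ T.cells, IntegrableOn F (interior (simplex K))) :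
    ∫ x in T.domain, F x = ∑ K ∈ T.cells, ∫ x in interior (simplex K), F x := by
  rw [setIntegral_congr_set T.domain_ae_eq]
  exact integral_biUnion_finset _ (fun K _ => isOpen_interior.measurableSet)
    (fun K hK L hL h => T.disjoint_interior hK hL h) hF

theorem diam_le_meshSize {K : Finset (Pt d)} (hK : K ∈ T.cells) :
    Metric.diam (simplex K) ≤ T.meshSize :=
  le_csSup (T.cells.finite_toSet.image _).bddAbove (mem_image_of_mem _ hK)

theorem meshSize_nonneg : 0 ≤ T.meshSize :=
  Real.sSup_nonneg fun _ ⟨_, _, h⟩ => h ▸ Metric.diam_nonneg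

end Mesh

/-! ### Slope and oscillation of affine functions. -/

section AffineFunction

variable (f : Pt d →ᵃ[ℝ] ℝ)

/-- The slope of an affine function. -/
def affineSlope : Pt d →L[ℝ] ℝ := LinearMap.toContinuousLinearMap f.linear

theorem affine_sub_eq (x y : Pt d) : f x - f y = affineSlope f (x - y) := by
  have := f.linearMap_vsub x y
  simpa [affineSlope] using this.symm

theorem abs_affine_sub_le (x y : Pt d) : |f x - f y| ≤ ‖affineSlope f‖ * ‖x - y‖ := by
  rw [affine_sub_eq]
  exact (affineSlope f).le_opNorm _

theorem hasFDerivAt_affine (x : Pt d) : HasFDerivAt f (affineSlope f) x := by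
  have h : (f : Pt d → ℝ) = fun y => affineSlope f y + f 0 := by
    ext y
    rw [← sub_eq_iff_eq_add, affine_sub_eq, sub_zero]
  rw [h]
  exact (affineSlope f).hasFDerivAt.add_const _

/-- An affine function is both convex and concave, so its values on the hull lie between values at
points of `s`. -/
theorem affine_sub_le_of_mem_convexHull {s : Set (Pt d)} {M : ℝ}
    (hM : ∀ p ∈ s, ∀ q ∈ s, f p - f q ≤ M) {y z : Pt d} (hy : y ∈ convexHull ℝ s)
    (hz : z ∈ convexHull ℝ s) : f y - f z ≤ M := by
  have hx : ConvexOn ℝ univ f :=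
    ⟨convex_univ, fun x _ y _ a b _ _ hab => (Convex.combo_affine_apply hab).le⟩
  have hv : ConcaveOn ℝ univ f :=
    ⟨convex_univ, fun x _ y _ a b _ _ hab => (Convex.combo_affine_apply hab).ge⟩
  obtain ⟨p, hp, h1⟩ := hx.exists_ge_of_mem_convexHull (subset_univ s) hy
  obtain ⟨q, hq, h2⟩ := hv.exists_le_of_mem_convexHull (subset_univ s) hz
  linarith [hM p hp q hq]

/-- An affine function on the convex hull of `s` has slope at most the quotient of its oscillation
on `s` by the diameter of an inscribed ball. -/
theorem norm_affineSlope_mul_le {s : Set (Pt d)} {M r : ℝ} {x : Pt d} (hr : 0 < r)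
    (hM : ∀ p ∈ s, ∀ q ∈ s, f p - f q ≤ M)
    (hball : Metric.closedBall x r ⊆ convexHull ℝ s) : ‖affineSlope f‖ * (2 * r) ≤ M := by
  have h2r : 0 < 2 * r := by positivity
  have hM0 : 0 ≤ M := by
    have hx := hball (Metric.mem_closedBall_self hr.le)
    simpa using affine_sub_le_of_mem_convexHull f hM hx hx
  rw [← le_div_iff₀ h2r]
  have key : ∀ v, affineSlope f v ≤ M / (2 * r) * ‖v‖ := by
    intro v
    rcases eq_or_ne v 0 with rfl | hv
    · simp
    have hv' : 0 < ‖v‖ := norm_pos_iff.2 hv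
    -- The points `x + e` and `x - e` are the ends of the diameter of the ball in direction `v`;
    -- their difference has length `2 * r`.
    set e : Pt d := (r / ‖v‖) • v
    have he : ‖e‖ = r := by
      rw [norm_smul, Real.norm_of_nonneg (by positivity), div_mul_cancel₀ _ hv'.ne']
    have h1 : x + e ∈ convexHull ℝ s := hball (by simp [he])
    have h2 : x - e ∈ convexHull ℝ s := hball (by simp [he])
    have h3 := affine_sub_le_of_mem_convexHull f hM h1 h2
    have h4 : x + e - (x - e) = (2 * r / ‖v‖) • v := by
      rw [mul_div_assoc, mul_smul, two_smul]
      simp only [e]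
      abel
    rw [affine_sub_eq, h4, map_smul, smul_eq_mul] at h3
    rw [div_mul_eq_mul_div, le_div_iff₀ h2r]
    rw [div_mul_eq_mul_div, div_le_iff₀ hv'] at h3
    linarith
  refine ContinuousLinearMap.opNorm_le_bound _ (by positivity) fun v => ?_
  rw [Real.norm_eq_abs, abs_le]
  have h5 := key (-v)
  rw [map_neg, norm_neg] at h5
  exact ⟨by linarith, key v⟩

end AffineFunction

theorem norm_gradient_eq {f : Pt d → ℝ} {L : Pt d →L[ℝ] ℝ} {x : Pt d} (h : HasFDerivAt f L x) :
    ‖gradient f x‖ = ‖L‖ := by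
  rw [gradient, h.fderiv, LinearIsometryEquiv.norm_map]

theorem norm_sub_le_diam_simplex {K : Finset (Pt d)} {p q : Pt d} (hp : p ∈ K) (hq : q ∈ K) :
    ‖p - q‖ ≤ Metric.diam (simplex K) := by
  rw [← dist_eq_norm]
  exact Metric.dist_le_diam_of_mem (isCompact_simplex K).isBounded (mem_simplex hp) (mem_simplex hq)

/-! ### Local equivalence of the weighted oscillation and the gradient. -/

namespace Mesh

variable (T : Mesh d) {K : Finset (Pt d)}

/-- The pointwise oscillation of vertex values, weighted by the nodal functions. -/
def hatOsc (G : Pt d → Pt d) (x : Pt d) : ℝ :=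
  ∑ p ∈ T.vertices, ∑ q ∈ T.vertices, T.hat p x * T.hat q x * ‖G p - G q‖ ^ 2

/-- The piecewise affine vector field with vertex values `G`. -/
def interp (G : Pt d → Pt d) (x : Pt d) : Pt d := ∑ p ∈ T.vertices, T.hat p x • G p

/-- The squared Frobenius norm of the gradient of a vector field. -/
def _root_.PG.gradSq (w : Pt d → Pt d) (x : Pt d) : ℝ :=
  ∑ i : Fin d, ‖gradient (fun y => w y i) x‖ ^ 2

/-- The squared Frobenius norm on a cell of the gradient of the interpolation of `G`. -/
def cellGradSq (K : Finset (Pt d)) (hK : K ∈ T.cells) (G : Pt d → Pt d) : ℝ :=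
  ∑ i : Fin d, ‖affineSlope (T.cellInterp K hK fun p => G p i)‖ ^ 2

theorem gradSq_interp (hK : K ∈ T.cells) (G : Pt d → Pt d) {x : Pt d}
    (hx : x ∈ interior (simplex K)) : gradSq (T.interp G) x = T.cellGradSq K hK G := by
  refine Finset.sum_congr rfl fun i _ => ?_
  rw [norm_gradient_eq]
  refine (hasFDerivAt_affine (T.cellInterp K hK fun p => G p i) x).congr_of_eventuallyEq ?_
  filter_upwards [mem_interior_iff_mem_nhds.1 hx] with y hy
  rw [T.cellInterp_eq hK _ hy]
  simp [interp]

theorem hatOsc_nonneg (G : Pt d → Pt d) {x : Pt d} (hx : x ∈ T.space) : 0 ≤ T.hatOsc G x :=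
  Finset.sum_nonneg fun p _ => Finset.sum_nonneg fun q _ =>
    mul_nonneg (mul_nonneg (T.hat_nonneg hx p) (T.hat_nonneg hx q)) (sq_nonneg _)

theorem hatOsc_eq (hK : K ∈ T.cells) (G : Pt d → Pt d) {x : Pt d} (hx : x ∈ simplex K) :
    T.hatOsc G x = ∑ p ∈ K, ∑ q ∈ K, T.hat p x * T.hat q x * ‖G p - G q‖ ^ 2 := by
  rw [hatOsc, T.sum_vertices_eq hK fun p hp => by simp [T.hat_eq_zero hK hp hx]]
  exact Finset.sum_congr rfl fun p _ =>
    T.sum_vertices_eq hK fun q hq => by simp [T.hat_eq_zero hK hq hx]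

theorem norm_sub_sq_le (hK : K ∈ T.cells) (G : Pt d → Pt d) {p q : Pt d} (hp : p ∈ K) (hq : q ∈ K) :
    ‖G p - G q‖ ^ 2 ≤ Metric.diam (simplex K) ^ 2 * T.cellGradSq K hK G := by
  rw [EuclideanSpace.norm_sq_eq, cellGradSq, Finset.mul_sum]
  refine Finset.sum_le_sum fun i _ => ?_
  have h := abs_affine_sub_le (T.cellInterp K hK fun p => G p i) p q
  rw [T.cellInterp_vertex hK _ hp, T.cellInterp_vertex hK _ hq] at h
  have h2 : |G p i - G q i| ≤
      Metric.diam (simplex K) * ‖affineSlope (T.cellInterp K hK fun p => G p i)‖ := by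
    rw [mul_comm]
    exact h.trans (mul_le_mul_of_nonneg_left (norm_sub_le_diam_simplex hp hq) (norm_nonneg _))
  rw [← mul_pow, PiLp.sub_apply, Real.norm_eq_abs]
  exact pow_le_pow_left₀ (abs_nonneg _) h2 2

/-- The weights `φ_p φ_q` over pairs of vertices of the cell sum to one, so the bound for a single
pair passes to their average. -/
theorem hatOsc_le (hK : K ∈ T.cells) (G : Pt d → Pt d) {x : Pt d} (hx : x ∈ simplex K) :
    T.hatOsc G x ≤ Metric.diam (simplex K) ^ 2 * T.cellGradSq K hK G := by
  have hxs := T.simplex_subset_space hK hx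
  have h1 : ∑ p ∈ K, T.hat p x = 1 := by
    rw [← T.sum_hat hxs, T.sum_vertices_eq hK fun p hp => T.hat_eq_zero hK hp hx]
  rw [T.hatOsc_eq hK G hx]
  calc _ ≤ ∑ p ∈ K, ∑ q ∈ K, T.hat p x * T.hat q x *
        (Metric.diam (simplex K) ^ 2 * T.cellGradSq K hK G) :=
        Finset.sum_le_sum fun p hp => Finset.sum_le_sum fun q hq =>
          mul_le_mul_of_nonneg_left (T.norm_sub_sq_le hK G hp hq)
            (mul_nonneg (T.hat_nonneg hxs p) (T.hat_nonneg hxs q))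
    _ = _ := by
        simp_rw [← Finset.sum_mul, ← Finset.mul_sum]
        rw [← Finset.sum_mul, h1, one_mul, one_mul]

/-- Inverse estimate on a cell: the gradient is bounded by the differences of the vertex values. -/
theorem sq_mul_cellGradSq_le (hK : K ∈ T.cells) (G : Pt d → Pt d) {x : Pt d} {r : ℝ} (hr : 0 < r)
    (hball : Metric.closedBall x r ⊆ simplex K) :
    (2 * r) ^ 2 * T.cellGradSq K hK G ≤ ∑ p ∈ K, ∑ q ∈ K, ‖G p - G q‖ ^ 2 := by
  have e : ∑ i : Fin d, ∑ p ∈ K, ∑ q ∈ K, (G p i - G q i) ^ 2 =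
      ∑ p ∈ K, ∑ q ∈ K, ‖G p - G q‖ ^ 2 := by
    rw [Finset.sum_comm]
    refine Finset.sum_congr rfl fun p _ => ?_
    rw [Finset.sum_comm]
    refine Finset.sum_congr rfl fun q _ => ?_
    rw [EuclideanSpace.norm_sq_eq]
    simp
  rw [← e, cellGradSq, Finset.mul_sum]
  refine Finset.sum_le_sum fun i _ => ?_
  set S := ∑ p ∈ K, ∑ q ∈ K, (G p i - G q i) ^ 2
  have hS : 0 ≤ S := Finset.sum_nonneg fun p _ => Finset.sum_nonneg fun q _ => sq_nonneg _
  have h : ‖affineSlope (T.cellInterp K hK fun p => G p i)‖ * (2 * r) ≤ √S := by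
    refine norm_affineSlope_mul_le _ hr (fun p hp q hq => ?_) hball
    rw [T.cellInterp_vertex hK _ hp, T.cellInterp_vertex hK _ hq]
    refine (le_abs_self _).trans (Real.abs_le_sqrt ?_)
    calc (G p i - G q i) ^ 2 ≤ ∑ q ∈ K, (G p i - G q i) ^ 2 :=
          Finset.single_le_sum (f := fun q => (G p i - G q i) ^ 2) (fun _ _ => sq_nonneg _) hq
      _ ≤ S := Finset.single_le_sum (f := fun p => ∑ q ∈ K, (G p i - G q i) ^ 2)
          (fun _ _ => Finset.sum_nonneg fun _ _ => sq_nonneg _) hp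
  rw [← mul_pow, mul_comm, ← Real.sq_sqrt hS]
  exact pow_le_pow_left₀ (by positivity) h 2

/-- The constant in the lower bound of the local mass matrix. -/
def _root_.PG.massConst (d : ℕ) : ℝ := (1 / 2) ^ d * (1 / (2 * (d + 1))) ^ 2

theorem _root_.PG.massConst_pos (d : ℕ) : 0 < massConst d := by
  unfold massConst
  positivity

/-- The image of a cell under the homothety with ratio `1 / 2` about its centroid. -/
theorem exists_center (hK : K ∈ T.cells) :
    ∃ b : Pt d, ∀ y ∈ AffineMap.homothety b (1 / 2 : ℝ) '' simplex K,
      y ∈ simplex K ∧ ∀ p ∈ K, 1 / (2 * (d + 1) : ℝ) ≤ T.hat p y := by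
  set b := Finset.univ.centroid ℝ (T.basis K hK) with hb
  have hc : ∀ p, (T.basis K hK).coord p b = 1 / (d + 1 : ℝ) := by
    intro p
    rw [hb, AffineBasis.coord_apply_centroid _ (Finset.mem_univ p)]
    simp [T.card_eq K hK]
  refine ⟨b, ?_⟩
  rintro - ⟨z, hz, rfl⟩
  have hcz := (T.mem_simplex_iff hK).1 hz
  -- Each barycentric coordinate is averaged with its value `1 / (d + 1)` at the centroid, so at
  -- least half of that value survives.
  have key : ∀ p, 1 / (2 * (d + 1) : ℝ) ≤
      (T.basis K hK).coord p (AffineMap.homothety b (1 / 2 : ℝ) z) := by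
    intro p
    rw [AffineMap.homothety_eq_lineMap, AffineMap.apply_lineMap, AffineMap.lineMap_apply_module, hc]
    rw [smul_eq_mul, smul_eq_mul]
    have e : (1 / (2 * (d + 1)) : ℝ) = (1 - 1 / 2) * (1 / (d + 1 : ℝ)) := by
      field_simp
      norm_num
    rw [e]
    exact le_add_of_nonneg_right (mul_nonneg (by norm_num) (hcz p))
  have hmem : AffineMap.homothety b (1 / 2 : ℝ) z ∈ simplex K :=
    (T.mem_simplex_iff hK).2 fun p => le_trans (by positivity) (key p)
  exact ⟨hmem, fun p hp => by rw [T.hat_eq_coord hK hp hmem]; exact key _⟩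

theorem integrableOn_hatOsc (hK : K ∈ T.cells) (G : Pt d → Pt d) :
    IntegrableOn (T.hatOsc G) (simplex K) :=
  ContinuousOn.integrableOn_compact (isCompact_simplex K) <|
    continuousOn_finsetSum _ fun p _ => continuousOn_finsetSum _ fun q _ =>
      ((T.continuousOn_hat hK p).mul (T.continuousOn_hat hK q)).mul continuousOn_const

/-- The local mass matrix is bounded below by the volume of the cell. -/
theorem massConst_mul_le (hK : K ∈ T.cells) (G : Pt d → Pt d) :
    massConst d * volume.real (simplex K) * ∑ p ∈ K, ∑ q ∈ K, ‖G p - G q‖ ^ 2 ≤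
      ∫ x in simplex K, T.hatOsc G x := by
  obtain ⟨b, hb⟩ := T.exists_center hK
  set A := AffineMap.homothety b (1 / 2 : ℝ) '' simplex K
  set S := ∑ p ∈ K, ∑ q ∈ K, ‖G p - G q‖ ^ 2
  have hAK : A ⊆ simplex K := fun y hy => (hb y hy).1
  have hAc : IsCompact A := (isCompact_simplex K).image (AffineMap.continuous_of_finiteDimensional _)
  have hvol : volume.real A = (1 / 2) ^ d * volume.real (simplex K) := by
    rw [measureReal_def, Measure.addHaar_image_homothety, finrank_euclideanSpace_fin,
      ENNReal.toReal_mul, ENNReal.toReal_ofReal (abs_nonneg _), abs_of_nonneg (by positivity)]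
    rfl
  -- The shrunken cell has the fraction `(1 / 2) ^ d` of the volume, and on it each of the two nodal
  -- factors is at least `1 / (2 * (d + 1))`. The nonnegative integrand may be dropped elsewhere.
  calc massConst d * volume.real (simplex K) * S
      = ∫ x in A, (1 / (2 * (d + 1) : ℝ)) ^ 2 * S := by
        rw [setIntegral_const, smul_eq_mul, hvol, massConst]
        ring
    _ ≤ ∫ x in A, T.hatOsc G x := by
        refine setIntegral_mono_on (integrableOn_const hAc.measure_lt_top.ne)
          ((T.integrableOn_hatOsc hK G).mono_set hAK) hAc.measurableSet fun y hy => ?_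
        rw [T.hatOsc_eq hK G (hAK hy), Finset.mul_sum]
        refine Finset.sum_le_sum fun p hp => ?_
        rw [Finset.mul_sum]
        refine Finset.sum_le_sum fun q hq => mul_le_mul_of_nonneg_right ?_ (sq_nonneg _)
        rw [sq]
        exact mul_le_mul ((hb y hy).2 p hp) ((hb y hy).2 q hq) (by positivity)
          (T.hat_nonneg (T.simplex_subset_space hK (hAK hy)) p)
    _ ≤ ∫ x in simplex K, T.hatOsc G x :=
        setIntegral_mono_set (T.integrableOn_hatOsc hK G)
          ((ae_restrict_iff' (isCompact_simplex K).measurableSet).2 (ae_of_all _ fun x hx =>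
            T.hatOsc_nonneg G (T.simplex_subset_space hK hx))) hAK.eventuallyLE

theorem interior_simplex_ae_eq (K : Finset (Pt d)) :
    interior (simplex K) =ᵐ[volume] simplex K :=
  interior_ae_eq_of_null_frontier ((convex_simplex K).addHaar_frontier volume)

theorem integral_interior_gradSq (hK : K ∈ T.cells) (G : Pt d → Pt d) :
    ∫ x in interior (simplex K), gradSq (T.interp G) x =
      volume.real (simplex K) * T.cellGradSq K hK G := by
  rw [setIntegral_congr_fun isOpen_interior.measurableSet
    (g := fun _ => T.cellGradSq K hK G) fun x hx => T.gradSq_interp hK G hx, setIntegral_const,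
    smul_eq_mul, measureReal_congr (interior_simplex_ae_eq K)]

theorem integrableOn_gradSq (hK : K ∈ T.cells) (G : Pt d → Pt d) :
    IntegrableOn (gradSq (T.interp G)) (interior (simplex K)) :=
  (integrableOn_const (C := T.cellGradSq K hK G) (((measure_mono interior_subset).trans_lt
    (isCompact_simplex K).measure_lt_top).ne)).congr_fun
    (fun _ hx => (T.gradSq_interp hK G hx).symm) isOpen_interior.measurableSet

theorem cellGradSq_nonneg (hK : K ∈ T.cells) (G : Pt d → Pt d) : 0 ≤ T.cellGradSq K hK G :=
  Finset.sum_nonneg fun _ _ => sq_nonneg _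

/-- The weighted oscillation is bounded by the gradient of the interpolation. -/
theorem integral_hatOsc_le {h : ℝ} (hh : ∀ K ∈ T.cells, Metric.diam (simplex K) ≤ h)
    (G : Pt d → Pt d) :
    ∫ x in T.domain, T.hatOsc G x ≤ h ^ 2 * ∫ x in T.domain, gradSq (T.interp G) x := by
  rw [T.integral_domain fun K hK => (T.integrableOn_hatOsc hK G).mono_set interior_subset,
    T.integral_domain fun K hK => T.integrableOn_gradSq hK G, Finset.mul_sum]
  refine Finset.sum_le_sum fun K hK => ?_
  rw [T.integral_interior_gradSq hK, setIntegral_congr_set (interior_simplex_ae_eq K)]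
  calc ∫ x in simplex K, T.hatOsc G x
      ≤ ∫ x in simplex K, Metric.diam (simplex K) ^ 2 * T.cellGradSq K hK G :=
        setIntegral_mono_on (T.integrableOn_hatOsc hK G)
          (integrableOn_const (isCompact_simplex K).measure_lt_top.ne)
          (isCompact_simplex K).measurableSet fun x hx => T.hatOsc_le hK G hx
    _ = Metric.diam (simplex K) ^ 2 * (volume.real (simplex K) * T.cellGradSq K hK G) := by
        rw [setIntegral_const, smul_eq_mul]
        ring
    _ ≤ _ := mul_le_mul_of_nonneg_right
        (pow_le_pow_left₀ Metric.diam_nonneg (hh K hK) 2)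
        (mul_nonneg measureReal_nonneg (T.cellGradSq_nonneg hK G))

/-- Inverse estimate: the gradient of the interpolation is bounded by the weighted oscillation. -/
theorem integral_gradSq_le {h σ τ : ℝ} (h0 : 0 ≤ h) (hσ : T.ShapeRegular σ)
    (hτ : ∀ K ∈ T.cells, h ≤ τ * Metric.diam (simplex K)) (G : Pt d → Pt d) :
    h ^ 2 * ∫ x in T.domain, gradSq (T.interp G) x ≤
      (τ * σ) ^ 2 / massConst d * ∫ x in T.domain, T.hatOsc G x := by
  rw [T.integral_domain fun K hK => (T.integrableOn_hatOsc hK G).mono_set interior_subset,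
    T.integral_domain fun K hK => T.integrableOn_gradSq hK G, Finset.mul_sum, Finset.mul_sum]
  refine Finset.sum_le_sum fun K hK => ?_
  rw [T.integral_interior_gradSq hK, setIntegral_congr_set (interior_simplex_ae_eq K)]
  obtain ⟨x, r, hr, hball, hdiam⟩ := hσ K hK
  have hg := T.cellGradSq_nonneg hK G
  have hv : 0 ≤ volume.real (simplex K) := measureReal_nonneg
  have hc := massConst_pos d
  -- The chain is `h ≤ τ h_K` and `h_K ≤ σ (2 r)`. Each link is squared separately, which avoids any
  -- sign condition on `τ`.
  have hh : h ^ 2 ≤ (τ * σ) ^ 2 * (2 * r) ^ 2 := by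
    have h1 : h ^ 2 ≤ τ ^ 2 * Metric.diam (simplex K) ^ 2 := by
      rw [← mul_pow]; exact pow_le_pow_left₀ h0 (hτ K hK) 2
    have h2 : Metric.diam (simplex K) ^ 2 ≤ σ ^ 2 * (2 * r) ^ 2 := by
      rw [← mul_pow]; exact pow_le_pow_left₀ Metric.diam_nonneg hdiam 2
    calc h ^ 2 ≤ τ ^ 2 * Metric.diam (simplex K) ^ 2 := h1
      _ ≤ τ ^ 2 * (σ ^ 2 * (2 * r) ^ 2) := mul_le_mul_of_nonneg_left h2 (sq_nonneg _)
      _ = _ := by ring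
  calc h ^ 2 * (volume.real (simplex K) * T.cellGradSq K hK G)
      ≤ (τ * σ) ^ 2 * (2 * r) ^ 2 * (volume.real (simplex K) * T.cellGradSq K hK G) :=
        mul_le_mul_of_nonneg_right hh (mul_nonneg hv hg)
    _ = (τ * σ) ^ 2 / massConst d *
        (massConst d * volume.real (simplex K) * ((2 * r) ^ 2 * T.cellGradSq K hK G)) := by
        field_simp
    _ ≤ (τ * σ) ^ 2 / massConst d *
        (massConst d * volume.real (simplex K) * ∑ p ∈ K, ∑ q ∈ K, ‖G p - G q‖ ^ 2) := by
        gcongr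
        exact T.sq_mul_cellGradSq_le hK G hr hball
    _ ≤ _ := mul_le_mul_of_nonneg_left (T.massConst_mul_le hK G) (by positivity)

end Mesh

/-! ### Uniqueness and linearity of weak gradients. -/

theorem integral_smul_add_smul {α E : Type*} [MeasurableSpace α] {μ : Measure α}
    [NormedAddCommGroup E] [NormedSpace ℝ E] {f g : α → E} (hf : Integrable f μ)
    (hg : Integrable g μ) (a b : ℝ) :
    ∫ x, a • f x + b • g x ∂μ = a • (∫ x, f x ∂μ) + b • ∫ x, g x ∂μ := by
  have h := integral_add (hf.smul a) (hg.smul b)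
  simp only [Pi.smul_apply] at h
  rw [h, integral_smul, integral_smul]

section WeakGradient

variable {U : Set (Pt d)} {u u₁ u₂ : Pt d → ℝ} {g g₁ g₂ : Pt d → Pt d}

theorem IsWeakGrad.integrable_smul (hg : MemLp g 2 (volume.restrict U)) {φ : Pt d → ℝ}
    (hφ : Continuous φ) (hc : HasCompactSupport φ) :
    IntegrableOn (fun x => φ x • g x) U := by
  have h : MemLp φ 2 (volume.restrict U) := (hφ.memLp_of_hasCompactSupport hc).restrict U
  exact memLp_one_iff_integrable.1 (hg.smul h)

/-- The difference integrates to zero against every test function, so the fundamental lemma of the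
calculus of variations applies. -/
theorem IsWeakGrad.ae_eq (hU : IsOpen U) (h₁ : IsWeakGrad U u g₁) (h₂ : IsWeakGrad U u g₂) :
    g₁ =ᵐ[volume.restrict U] g₂ := by
  have hd : MemLp (fun x => g₁ x - g₂ x) 2 (volume.restrict U) := h₁.1.sub h₂.1
  have hloc : LocallyIntegrableOn (fun x => g₁ x - g₂ x) U :=
    locallyIntegrableOn_of_locallyIntegrable_restrict (hd.locallyIntegrable one_le_two)
  have h := hU.ae_eq_zero_of_integral_contDiff_smul_eq_zero hloc ?_
  · rw [Filter.EventuallyEq, ae_restrict_iff' hU.measurableSet]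
    filter_upwards [h] with x hx hxU
    exact sub_eq_zero.1 (hx hxU)
  · intro φ hφ hc hsupp
    have e : ∫ x, φ x • (g₁ x - g₂ x) = ∫ x in U, φ x • (g₁ x - g₂ x) := by
      refine (setIntegral_eq_integral_of_forall_compl_eq_zero fun x hx => ?_).symm
      rw [image_eq_zero_of_notMem_tsupport fun h => hx (hsupp h), zero_smul]
    rw [e]
    simp_rw [smul_sub]
    rw [integral_sub (IsWeakGrad.integrable_smul h₁.1 hφ.continuous hc)
      (IsWeakGrad.integrable_smul h₂.1 hφ.continuous hc), sub_eq_zero]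
    exact neg_injective ((h₁.2 φ hφ hc hsupp).symm.trans (h₂.2 φ hφ hc hsupp))

theorem integrableOn_smul_gradient (hu : MemLp u 2 (volume.restrict U)) {φ : Pt d → ℝ}
    (hφ : ContDiff ℝ ∞ φ) (hc : HasCompactSupport φ) :
    IntegrableOn (fun x => u x • gradient φ x) U := by
  have h1 : Continuous (gradient φ) :=
    (InnerProductSpace.toDual ℝ (Pt d)).symm.continuous.comp (hφ.continuous_fderiv (by simp))
  have h2 : HasCompactSupport (gradient φ) :=
    (hc.fderiv ℝ).comp_left (g := (InnerProductSpace.toDual ℝ (Pt d)).symm) (map_zero _)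
  have h3 : MemLp (gradient φ) 2 (volume.restrict U) :=
    (h1.memLp_of_hasCompactSupport h2).restrict U
  exact memLp_one_iff_integrable.1 (h3.smul hu)

theorem IsWeakGrad.lincomb (hu₁ : MemLp u₁ 2 (volume.restrict U))
    (hu₂ : MemLp u₂ 2 (volume.restrict U)) (h₁ : IsWeakGrad U u₁ g₁) (h₂ : IsWeakGrad U u₂ g₂)
    (a b : ℝ) : IsWeakGrad U (a • u₁ + b • u₂) (a • g₁ + b • g₂) := by
  refine ⟨(h₁.1.const_smul a).add (h₂.1.const_smul b), fun φ hφ hc hsupp => ?_⟩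
  have e1 : ∀ x, (a • u₁ + b • u₂) x • gradient φ x =
      a • (u₁ x • gradient φ x) + b • (u₂ x • gradient φ x) := fun x => by
    simp only [Pi.add_apply, Pi.smul_apply, smul_eq_mul, add_smul, mul_smul]
  have e2 : ∀ x, φ x • (a • g₁ + b • g₂) x = a • (φ x • g₁ x) + b • (φ x • g₂ x) := fun x => by
    simp only [Pi.add_apply, Pi.smul_apply, smul_add, smul_comm (φ x)]
  simp_rw [e1, e2]
  rw [integral_smul_add_smul (integrableOn_smul_gradient hu₁ hφ hc)
      (integrableOn_smul_gradient hu₂ hφ hc),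
    integral_smul_add_smul (IsWeakGrad.integrable_smul h₁.1 hφ.continuous hc)
      (IsWeakGrad.integrable_smul h₂.1 hφ.continuous hc)]
  rw [h₁.2 φ hφ hc hsupp, h₂.2 φ hφ hc hsupp]
  simp only [smul_neg, neg_add]

theorem MemH1.isWeakGrad (hu : MemH1 U u) : IsWeakGrad U u (weakGrad U u) := by
  rw [weakGrad, dif_pos hu.2]
  exact hu.2.choose_spec

theorem weakGrad_lincomb (hU : IsOpen U) (hu₁ : MemH1 U u₁) (hu₂ : MemH1 U u₂) (a b : ℝ) :
    weakGrad U (a • u₁ + b • u₂) =ᵐ[volume.restrict U] a • weakGrad U u₁ + b • weakGrad U u₂ := by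
  have h := hu₁.isWeakGrad.lincomb hu₁.1 hu₂.1 hu₂.isWeakGrad a b
  have hm : MemH1 U (a • u₁ + b • u₂) := ⟨(hu₁.1.const_smul a).add (hu₂.1.const_smul b), _, h⟩
  exact hm.isWeakGrad.ae_eq hU h

end WeakGradient

/-! ### Coefficients of the lumped-mass projection. -/

namespace Mesh

variable (T : Mesh d) (Ω : Set (Pt d)) {v w : Pt d → Pt d}

theorem nodes_subset_vertices : T.nodes Ω ⊆ T.vertices := by
  classical
  exact Finset.filter_subset _ _

theorem hat_nonneg_ae (p : Pt d) : 0 ≤ᵐ[volume.restrict T.domain] T.hat p :=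
  (ae_restrict_iff' T.isOpen_domain.measurableSet).2
    (ae_of_all _ fun _ hx => T.hat_nonneg (T.domain_subset_space hx) p)

/-- This survives a vanishing mass: a nonnegative nodal function with zero integral vanishes almost
everywhere, so both sides are zero. -/
theorem integral_hat_smul_coeff (v : Pt d → Pt d) {p : Pt d} (hp : p ∈ T.vertices) :
    (∫ x in T.domain, T.hat p x) • T.coeff v p = ∫ x in T.domain, T.hat p x • v x := by
  by_cases h : ∫ x in T.domain, T.hat p x = 0
  · have h0 := (integral_eq_zero_iff_of_nonneg_ae (T.hat_nonneg_ae p)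
      ((T.memLp_hat hp).integrable le_top)).1 h
    rw [h, zero_smul, integral_congr_ae (g := fun _ => 0), integral_zero]
    filter_upwards [h0] with x hx
    rw [hx, Pi.zero_apply, zero_smul]
  · rw [coeff, smul_inv_smul₀ h]

open Classical in
/-- The coefficients of the projection, extended by zero to all vertices. -/
def projCoeff (v : Pt d → Pt d) (p : Pt d) : Pt d := if p ∈ T.nodes Ω then T.coeff v p else 0

/-- Passing to all vertices restores the partition of unity, which the nodal functions of `T.nodes
Ω` alone need not form. -/
theorem proj_eq_interp (v : Pt d → Pt d) : T.proj Ω v = T.interp (T.projCoeff Ω v) := by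
  classical
  ext1 x
  rw [proj, interp, ← Finset.sum_subset (T.nodes_subset_vertices Ω)]
  · exact Finset.sum_congr rfl fun p hp => by rw [projCoeff, if_pos hp]
  · intro p _ hp
    rw [projCoeff, if_neg hp, smul_zero]

/-- Needed because `weakGrad` is an arbitrary representative, additive only almost everywhere. -/
theorem coeff_congr (h : v =ᵐ[volume.restrict T.domain] w) (p : Pt d) :
    T.coeff v p = T.coeff w p := by
  rw [coeff, coeff, integral_congr_ae (g := fun x => T.hat p x • w x)]
  filter_upwards [h] with x hx
  rw [hx]

theorem integrableOn_hat_smul (hv : MemLp v 2 (volume.restrict T.domain)) {p : Pt d}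
    (hp : p ∈ T.vertices) : IntegrableOn (fun x => T.hat p x • v x) T.domain :=
  (memLp_two_smul_of_memLp_top (T.memLp_hat hp) hv).integrable one_le_two

theorem coeff_lincomb (hv : MemLp v 2 (volume.restrict T.domain))
    (hw : MemLp w 2 (volume.restrict T.domain)) (a b : ℝ) {p : Pt d} (hp : p ∈ T.vertices) :
    T.coeff (a • v + b • w) p = a • T.coeff v p + b • T.coeff w p := by
  have e : ∀ x, T.hat p x • (a • v + b • w) x = a • (T.hat p x • v x) + b • (T.hat p x • w x) :=
    fun x => by simp only [Pi.add_apply, Pi.smul_apply, smul_add, smul_comm (T.hat p x)]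
  simp only [coeff, e]
  rw [integral_smul_add_smul (T.integrableOn_hat_smul hv hp) (T.integrableOn_hat_smul hw hp),
    smul_add, smul_comm a, smul_comm b]

end Mesh

/-! ### Bilinearity, symmetry and the diagonal of the stabilization form. -/

variable (T : Mesh d) (Ω : Set (Pt d)) {u u₁ u₂ v : Pt d → ℝ}

/-- Both terms are symmetric and bilinear in the two gradients; symmetry and linearity of the form
are read off from here. -/
theorem stabForm_eq (hu : MemLp (weakGrad T.domain u) 2 (volume.restrict T.domain))
    (hv : MemLp (weakGrad T.domain v) 2 (volume.restrict T.domain)) :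
    stabForm T Ω u v =
      (∫ x in T.domain, inner ℝ (weakGrad T.domain u x) (weakGrad T.domain v x)) -
      ∑ p ∈ T.nodes Ω, (∫ x in T.domain, T.hat p x) *
        inner ℝ (T.coeff (weakGrad T.domain u) p) (T.coeff (weakGrad T.domain v) p) :=
  integral_inner_sub_sum_smul (fun _ hp => T.memLp_hat (T.nodes_subset_vertices Ω hp)) hu hv
    fun _ hp => T.integral_hat_smul_coeff _ (T.nodes_subset_vertices Ω hp)

theorem stabForm_comm (hu : MemH1 T.domain u) (hv : MemH1 T.domain v) :
    stabForm T Ω u v = stabForm T Ω v u := by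
  rw [stabForm_eq T Ω hu.isWeakGrad.1 hv.isWeakGrad.1, stabForm_eq T Ω hv.isWeakGrad.1 hu.isWeakGrad.1]
  simp_rw [real_inner_comm]

theorem stabForm_lincomb_left (hu₁ : MemH1 T.domain u₁) (hu₂ : MemH1 T.domain u₂)
    (hv : MemH1 T.domain v) (a b : ℝ) :
    stabForm T Ω (a • u₁ + b • u₂) v = a * stabForm T Ω u₁ v + b * stabForm T Ω u₂ v := by
  have h₁ := hu₁.isWeakGrad.1
  have h₂ := hu₂.isWeakGrad.1
  have h := hv.isWeakGrad.1
  have hl := weakGrad_lincomb T.isOpen_domain hu₁ hu₂ a b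
  have hm : MemLp (weakGrad T.domain (a • u₁ + b • u₂)) 2 (volume.restrict T.domain) :=
    ((h₁.const_smul a).add (h₂.const_smul b)).ae_eq hl.symm
  rw [stabForm_eq T Ω hm h, stabForm_eq T Ω h₁ h, stabForm_eq T Ω h₂ h]
  have e1 : ∫ x in T.domain,
      inner ℝ (weakGrad T.domain (a • u₁ + b • u₂) x) (weakGrad T.domain v x) =
      a * (∫ x in T.domain, inner ℝ (weakGrad T.domain u₁ x) (weakGrad T.domain v x)) +
      b * ∫ x in T.domain, inner ℝ (weakGrad T.domain u₂ x) (weakGrad T.domain v x) := by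
    rw [← smul_eq_mul, ← smul_eq_mul, ← integral_smul_add_smul
      (integrable_inner_of_memLp_two h₁ h) (integrable_inner_of_memLp_two h₂ h)]
    refine integral_congr_ae ?_
    filter_upwards [hl] with x hx
    rw [hx, Pi.add_apply, Pi.smul_apply, Pi.smul_apply, inner_add_left, real_inner_smul_left,
      real_inner_smul_left, smul_eq_mul, smul_eq_mul]
  have e2 : ∀ p ∈ T.nodes Ω, (∫ x in T.domain, T.hat p x) *
      inner ℝ (T.coeff (weakGrad T.domain (a • u₁ + b • u₂)) p) (T.coeff (weakGrad T.domain v) p) =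
      a * ((∫ x in T.domain, T.hat p x) *
        inner ℝ (T.coeff (weakGrad T.domain u₁) p) (T.coeff (weakGrad T.domain v) p)) +
      b * ((∫ x in T.domain, T.hat p x) *
        inner ℝ (T.coeff (weakGrad T.domain u₂) p) (T.coeff (weakGrad T.domain v) p)) := by
    intro p hp
    rw [T.coeff_congr hl, T.coeff_lincomb h₁ h₂ a b (T.nodes_subset_vertices Ω hp), inner_add_left,
      real_inner_smul_left, real_inner_smul_left]
    ring
  rw [e1, Finset.sum_congr rfl e2, Finset.sum_add_distrib, ← Finset.mul_sum, ← Finset.mul_sum]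
  ring

/-- The stabilization form is the squared fluctuation plus half the weighted oscillation of the
coefficients. -/
theorem stabForm_self_eq (hu : MemH1 T.domain u) :
    stabForm T Ω u u = fluctSq T Ω u +
      (1 / 2) * ∫ x in T.domain, T.hatOsc (T.projCoeff Ω (weakGrad T.domain u)) x := by
  classical
  rw [stabForm, fluctSq, T.proj_eq_interp]
  refine integral_inner_sub_sum_smul_self (fun _ hp => T.memLp_hat hp) ?_ hu.isWeakGrad.1 ?_
  · exact (ae_restrict_iff' T.isOpen_domain.measurableSet).2
      (ae_of_all _ fun _ hx => T.sum_hat (T.domain_subset_space hx))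
  -- A nonzero extended coefficient belongs to a node, where it is the true moment quotient.
  · intro p hp h
    have hn : p ∈ T.nodes Ω := by
      by_contra hn
      exact h (if_neg hn)
    rw [Mesh.projCoeff, if_pos hn]
    exact T.integral_hat_smul_coeff _ hp

theorem projGradSq_eq : projGradSq T Ω u =
    ∫ x in T.domain, gradSq (T.interp (T.projCoeff Ω (weakGrad T.domain u))) x := by
  rw [projGradSq, T.proj_eq_interp]
  rfl

theorem fluctSq_nonneg : 0 ≤ fluctSq T Ω u := integral_nonneg fun _ => sq_nonneg _

theorem Mesh.integral_hatOsc_nonneg (G : Pt d → Pt d) : 0 ≤ ∫ x in T.domain, T.hatOsc G x :=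
  setIntegral_nonneg T.isOpen_domain.measurableSet fun _ hx =>
    T.hatOsc_nonneg G (T.domain_subset_space hx)

theorem Mesh.mem_cells_of_mem_sub {D : Set (Pt d)} {δ : ℝ} {K : Finset (Pt d)}
    (hK : K ∈ (T.sub D δ).cells) : K ∈ T.cells := by
  classical
  exact (Finset.mem_filter.1 hK).1

end PG

end

/-- The constants depend only on `d`, the shape regularity constant `σ` and the quasiuniformity
constant `τ`. Here `T` is the triangulation of `Ω`, `D ⊆ Ω` is the subdomain `Ω_k`,
`T.sub D δ` is the sub-triangulation `T_{h,k}(δ)`, and its domain is `Ω_{h,k}(δ)`. -/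
theorem lemma4p1 (d : ℕ) (σ τ : ℝ) :
    ∃ c C : ℝ, 0 < c ∧ 0 < C ∧
      ∀ (Ω D : Set (PG.Pt d)) (T : PG.Mesh d) (δ : ℝ),
        interior (closure Ω) = Ω → D ⊆ Ω → T.space = closure Ω → T.ShapeRegular σ → T.QuasiUniform τ → 0 ≤ δ →
        (∀ u₁ u₂ v : PG.Pt d → ℝ, PG.MemH1 (T.sub D δ).domain u₁ →
          PG.MemH1 (T.sub D δ).domain u₂ → PG.MemH1 (T.sub D δ).domain v → ∀ a b : ℝ,
          PG.stabForm (T.sub D δ) Ω (a • u₁ + b • u₂) v =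
            a * PG.stabForm (T.sub D δ) Ω u₁ v + b * PG.stabForm (T.sub D δ) Ω u₂ v) ∧
        (∀ u v : PG.Pt d → ℝ, PG.MemH1 (T.sub D δ).domain u → PG.MemH1 (T.sub D δ).domain v →
          PG.stabForm (T.sub D δ) Ω u v = PG.stabForm (T.sub D δ) Ω v u) ∧
        (∀ u : PG.Pt d → ℝ, PG.MemH1 (T.sub D δ).domain u →
          0 ≤ PG.stabForm (T.sub D δ) Ω u u ∧
          c * (PG.fluctSq (T.sub D δ) Ω u + T.meshSize ^ 2 * PG.projGradSq (T.sub D δ) Ω u) ≤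
            PG.stabForm (T.sub D δ) Ω u u ∧
          PG.stabForm (T.sub D δ) Ω u u ≤
            C * (PG.fluctSq (T.sub D δ) Ω u +
              T.meshSize ^ 2 * PG.projGradSq (T.sub D δ) Ω u)) := by
  set A : ℝ := (τ * σ) ^ 2 / PG.massConst d with hA
  have hA0 : 0 ≤ A := div_nonneg (sq_nonneg _) (PG.massConst_pos d).le
  -- With `Q = h²‖∇P∇u‖²` one has `J ≤ Q ≤ A J` and `s = F + J/2`. Thus `s ≤ F + Q` and `F + Q ≤ F +
  -- A J ≤ 2 (A + 1) (F + J/2)`.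
  refine ⟨1 / (2 * (A + 1)), 1, by positivity, one_pos, ?_⟩
  intro Ω D T δ _ _ _ hσ hτ _
  refine ⟨fun u₁ u₂ v hu₁ hu₂ hv a b => PG.stabForm_lincomb_left _ Ω hu₁ hu₂ hv a b,
    fun u v hu hv => PG.stabForm_comm _ Ω hu hv, fun u hu => ?_⟩
  have hsub : ∀ K ∈ (T.sub D δ).cells, K ∈ T.cells := fun K hK => T.mem_cells_of_mem_sub hK
  set G := (T.sub D δ).projCoeff Ω (PG.weakGrad (T.sub D δ).domain u)
  have hF : 0 ≤ PG.fluctSq (T.sub D δ) Ω u := PG.fluctSq_nonneg _ Ω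
  -- The estimates run over the cells of the sub-triangulation, but with the mesh size of the full
  -- `T`; both bounds on `h` are inherited cell by cell.
  have hJ := (T.sub D δ).integral_hatOsc_nonneg G
  have hup := (T.sub D δ).integral_hatOsc_le (fun K hK => T.diam_le_meshSize (hsub K hK)) G
  have hlow := (T.sub D δ).integral_gradSq_le T.meshSize_nonneg (fun K hK => hσ K (hsub K hK))
    (fun K hK => hτ K (hsub K hK)) G
  rw [PG.stabForm_self_eq _ Ω hu, PG.projGradSq_eq]
  rw [← hA] at hlow
  refine ⟨by linarith, ?_, by linarith⟩
  rw [div_mul_eq_mul_div, one_mul, div_le_iff₀ (by positivity)]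
  have h1 := mul_nonneg hA0 hF
  linarith
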